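/- Let $d\in\mathbb N$. For $x,\omega\in\mathbb R^n$ let $\rho(x,\omega)$ be the time-frequency shift $\rho(x,\omega)f(t)=e^{-\pi i x\cdot\omega}e^{2\pi i\omega\cdot t}f(t-x)$ on $L^2(\mathbb R^n)$. A unitary operator $\widehat{\mathcal A}$ on $L^2(\mathbb R^n)$ is called a metaplectic operator associated to $\mathcal A\in\mathrm{Sp}(2n,\mathbb R)$ if $\rho(\mathcal A\lambda)=\widehat{\mathcal A}\,\rho(\lambda)\,\widehat{\mathcal A}^{-1}$ for all $\lambda\in\mathbb R^{2n}$. For $\boldsymbol{\mathcal A}\in\mathrm{Sp}(4d,\mathbb R)$, a metaplectic operator $\widehat{\boldsymbol{\mathcal A}}$ on $L^2(\mathbb R^{2d})$ associated to $\boldsymbol{\mathcal A}$, and $f,g\in L^2(\mathbb R^d)$, the metaplectic time-frequency representation is $W_{\boldsymbol{\mathcal A}}(f,g)=\widehat{\boldsymbol{\mathcal A}}(f\otimes\overline g)$. Let $\boldsymbol{\mathcal A}\in\mathrm{Sp}(4d,\mathbb R)$ have a pre-Iwasawa decomposition $$\boldsymbol{\mathcal A}=\begin{pmatrix}I&0\\Q&I\end{pmatrix}\begin{pmatrix}L&0\\0&(L^t)^{-1}\end{pmatrix}\begin{pmatrix}A&B\\-B&A\end{pmatrix},$$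 with $Q=Q^t\in\mathbb R^{2d\times2d}$, $L\in\mathrm{GL}(2d,\mathbb R)$ and $U=A+iB\in\mathrm U(2d,\mathbb C)$ ($A,B$ real), and assume that $U^tU$ is $d\times d$ block-diagonal, i.e. $U^tU=\begin{pmatrix}U_1&0\\0&U_2\end{pmatrix}$ with $U_1,U_2\in\mathbb C^{d\times d}$. Then metaplectic operators associated to $\boldsymbol{\mathcal A}$ exist, and there are non-zero $f,g\in L^2(\mathbb R^d)$ such that, for every metaplectic operator $\widehat{\boldsymbol{\mathcal A}}$ associated to $\boldsymbol{\mathcal A}$, the function $W_{\boldsymbol{\mathcal A}}(f,g)$ has compact support (it vanishes almost everywhere outside a compact set). Moreover, the same $f,g$ can be chosen so that $W_{\boldsymbol{\mathcal A}}(f,g)$ satisfies arbitrary decay and integrability conditions: for every continuous $\varphi:\mathbb R^{2d}\to(0,\infty)$ there is a constant $C$ with $|W_{\boldsymbol{\mathcal A}}(f,g)(\lambda)|\le C\varphi(\lambda)$ for almost all $\lambda$, and for every $p\in(0,\infty)$ and every locally integrable $v:\mathbb R^{2d}\to\mathbb R$ the function $|W_{\boldsymbol{\mathcal A}}(f,g)|^p\,v$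 is integrable on $\mathbb R^{2d}$. Hence no condition of this type on $W_{\boldsymbol{\mathcal A}}(f,g)$ can force $f=0$ or $g=0$. -/

import Mathlib

open MeasureTheory Matrix

noncomputable section

/-- The Hilbert space `L²(ℝ^ι)` of complex-valued functions, with respect to Lebesgue measure. -/
abbrev L2 (ι : Type) [Fintype ι] : Type :=
  Lp ℂ 2 (volume : Measure (EuclideanSpace ℝ ι))

/-- The symmetric time-frequency shift `ρ(x, ω)` on functions:
`ρ(x, ω) f (t) = e^{-π i x·ω} e^{2 π i ω·t} f (t - x)`. -/
def tfShiftFun {ι : Type} [Fintype ι] (x ω : EuclideanSpace ℝ ι)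
    (f : EuclideanSpace ℝ ι → ℂ) (t : EuclideanSpace ℝ ι) : ℂ :=
  Complex.exp (((-(Real.pi * inner ℝ x ω) : ℝ) : ℂ) * Complex.I) *
    Complex.exp (((2 * Real.pi * inner ℝ ω t : ℝ) : ℂ) * Complex.I) * f (t - x)

theorem memLp_tfShiftFun {ι : Type} [Fintype ι] (x ω : EuclideanSpace ℝ ι)
    (f : EuclideanSpace ℝ ι → ℂ) (hf : MemLp f 2 volume) :
    MemLp (tfShiftFun x ω f) 2 volume := by
  have h : MemLp (fun t => f (t - x)) 2 volume :=
    hf.comp_measurePreserving (measurePreserving_sub_right volume x)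
  refine h.congr_norm ?_ (Filter.Eventually.of_forall fun t => ?_)
  · refine AEStronglyMeasurable.mul (Continuous.aestronglyMeasurable ?_) h.1
    fun_prop
  · simp only [tfShiftFun, norm_mul, Complex.norm_exp_ofReal_mul_I, one_mul]

/-- The symmetric time-frequency shift `ρ(x, ω)` on `L²(ℝ^ι)`. -/
def tfShift {ι : Type} [Fintype ι] (x ω : EuclideanSpace ℝ ι) (f : L2 ι) : L2 ι :=
  (memLp_tfShiftFun x ω f (Lp.memLp f)).toLp (tfShiftFun x ω f)

/-- `ρ(l)` for a point `l = (x, ω)` of phase space `ℝ^ι × ℝ^ι`. -/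
def phaseShift {ι : Type} [Fintype ι] (l : ι ⊕ ι → ℝ) (f : L2 ι) : L2 ι :=
  tfShift (WithLp.toLp 2 fun i => l (Sum.inl i)) (WithLp.toLp 2 fun i => l (Sum.inr i)) f

/-- The unitary operator `T` on `L²(ℝ^ι)` is a metaplectic operator associated to the matrix `A`:
`ρ(A l) = T ρ(l) T⁻¹` for all `l` in phase space. -/
def IsMetaplectic {ι : Type} [Fintype ι] (A : Matrix (ι ⊕ ι) (ι ⊕ ι) ℝ)
    (T : L2 ι ≃ₗᵢ[ℂ] L2 ι) : Prop :=
  ∀ (l : ι ⊕ ι → ℝ) (f : L2 ι), phaseShift (A *ᵥ l) f = T (phaseShift l (T.symm f))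

/-- The elementary tensor `(f ⊗ g)(x, y) = f(x) g(y)` of functions. -/
def tensorFun {ι κ : Type} (f : EuclideanSpace ℝ ι → ℂ)
    (g : EuclideanSpace ℝ κ → ℂ) (z : EuclideanSpace ℝ (ι ⊕ κ)) : ℂ :=
  f (WithLp.toLp 2 fun i => z (Sum.inl i)) * g (WithLp.toLp 2 fun j => z (Sum.inr j))

theorem measurePreserving_split (ι κ : Type) [Fintype ι] [Fintype κ] :
    MeasurePreserving (fun z : EuclideanSpace ℝ (ι ⊕ κ) =>
      ((WithLp.toLp 2 fun i => z (Sum.inl i), WithLp.toLp 2 fun j => z (Sum.inr j)) :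
        EuclideanSpace ℝ ι × EuclideanSpace ℝ κ)) volume (volume.prod volume) :=
  ((PiLp.volume_preserving_toLp ι).prod (PiLp.volume_preserving_toLp κ)).comp
    ((volume_measurePreserving_sumPiEquivProdPi (fun _ : ι ⊕ κ => ℝ)).comp
      (PiLp.volume_preserving_ofLp (ι ⊕ κ)))

theorem memLp_tensorFun {ι κ : Type} [Fintype ι] [Fintype κ] (f : EuclideanSpace ℝ ι → ℂ)
    (g : EuclideanSpace ℝ κ → ℂ) (hf : MemLp f 2 volume) (hg : MemLp g 2 volume) :
    MemLp (tensorFun f g) 2 volume := by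
  have h : MemLp (fun p : EuclideanSpace ℝ ι × EuclideanSpace ℝ κ => f p.1 * g p.2) 2
      (volume.prod volume) := by
    have hm : AEStronglyMeasurable
        (fun p : EuclideanSpace ℝ ι × EuclideanSpace ℝ κ => f p.1 * g p.2)
        (volume.prod volume) := hf.1.comp_fst.mul hg.1.comp_snd
    rw [memLp_two_iff_integrable_sq_norm hm]
    simp only [norm_mul, mul_pow]
    exact ((memLp_two_iff_integrable_sq_norm hf.1).1 hf).mul_prod
      ((memLp_two_iff_integrable_sq_norm hg.1).1 hg)
  exact h.comp_measurePreserving (measurePreserving_split ι κ)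

/-- The elementary tensor `f ⊗ g ∈ L²(ℝ^ι × ℝ^κ)` of `f ∈ L²(ℝ^ι)` and `g ∈ L²(ℝ^κ)`. -/
def tensor {ι κ : Type} [Fintype ι] [Fintype κ] (f : L2 ι) (g : L2 κ) : L2 (ι ⊕ κ) :=
  (memLp_tensorFun f g (Lp.memLp f) (Lp.memLp g)).toLp (tensorFun f g)

/-- The metaplectic time-frequency representation `W(f, g) = T (f ⊗ conj g)` given by a
(metaplectic) operator `T` on `L²(ℝ^{2d})`. -/
def metaplecticTFR {d : ℕ} (T : L2 (Fin d ⊕ Fin d) ≃ₗᵢ[ℂ] L2 (Fin d ⊕ Fin d))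
    (f g : L2 (Fin d)) : L2 (Fin d ⊕ Fin d) :=
  T (tensor f (star g))

/-- The elementary symplectic matrix `V_Q = (I, 0; Q, I)`. -/
def symplV {n : Type} [DecidableEq n] (Q : Matrix n n ℝ) : Matrix (n ⊕ n) (n ⊕ n) ℝ :=
  fromBlocks 1 0 Q 1

/-- The elementary symplectic matrix `D_L = (L, 0; 0, L^{-t})`. -/
def symplD {n : Type} [Fintype n] [DecidableEq n] (L : Matrix n n ℝ) :
    Matrix (n ⊕ n) (n ⊕ n) ℝ :=
  fromBlocks L 0 0 (Lᵀ)⁻¹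

/-- The elementary symplectic matrix `R_U = (A, B; -B, A)`, where `U = A + iB`. -/
def symplR {n : Type} (U : Matrix n n ℂ) : Matrix (n ⊕ n) (n ⊕ n) ℝ :=
  fromBlocks (U.map Complex.re) (U.map Complex.im) (-(U.map Complex.im)) (U.map Complex.re)

/-- A `2d × 2d` matrix is `d × d` block-diagonal. -/
def IsBlockDiag {d : ℕ} (M : Matrix (Fin d ⊕ Fin d) (Fin d ⊕ Fin d) ℂ) : Prop :=
  ∃ M₁ M₂ : Matrix (Fin d) (Fin d) ℂ, M = fromBlocks M₁ 0 0 M₂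

/-- An `L²` class has compact support: it vanishes almost everywhere off a compact set. -/
def HasCompactEssSupport {ι : Type} [Fintype ι] (F : L2 ι) : Prop :=
  ∃ K : Set (EuclideanSpace ℝ ι), IsCompact K ∧ ∀ᵐ z, z ∉ K → F z = 0

end

/-! `Uᵀ * U` is symmetric and unitary, so its blocks `U₁`, `U₂` have symmetric unitary square roots
`V₁`, `V₂`. With `V = diag(V₁, V₂)`, the unitary matrix `W = U V*` satisfies `Wᵀ W = 1`, hence is
real orthogonal, and `A = V_Q D_{LM} R_V` (`exists_block_factor`). Morally, a metaplectic operator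
of `A` applies `T₁ ⊗ T₂`, then a dilation, then a chirp. With `f = T₁⁻¹ φ` and `conj g = T₂⁻¹ φ`,
`φ` the indicator of a ball, the modulus of `W(f, g)` is a dilated indicator of a product of balls.

The proof needs neither the uniqueness of metaplectic operators up to phase nor the operator `T₁ ⊗
T₂`. For `F = T (f ⊗ conj g)`, the Fourier transform of `|F|²` is `ω ↦ ⟨F, ρ(0, ω) F⟩`
(`charFun_sqDensity`), and covariance alone evaluates this for every admissible `T`: it equals the
same expression for `φ ⊗ φ` at `(LM)ᵀ ω`. Uniqueness of characteristic functions makes `|F|²` the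
push-forward of `|φ ⊗ φ|²` under `LM` (`sqDensity_eq_map`), so `F` is bounded with compact support,
which gives all decay and integrability claims.

Existence is proved on generators: chirps, dilations, the Fourier transform, and products of these
for `R_U`. -/

noncomputable section

/-! ### Unitary matrices as symplectic matrices; symmetric square roots. -/

section SymplecticMatrices

variable {n : Type} [Fintype n]

theorem map_re_mul (U W : Matrix n n ℂ) :
    (U * W).map Complex.re =
      U.map Complex.re * W.map Complex.re - U.map Complex.im * W.map Complex.im := by
  ext i j
  simp [mul_apply, Finset.sum_sub_distrib]

theorem map_im_mul (U W : Matrix n n ℂ) :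
    (U * W).map Complex.im =
      U.map Complex.re * W.map Complex.im + U.map Complex.im * W.map Complex.re := by
  ext i j
  simp [mul_apply, Finset.sum_add_distrib]

theorem symplR_mul (U W : Matrix n n ℂ) : symplR (U * W) = symplR U * symplR W := by
  simp only [symplR, map_re_mul, map_im_mul, fromBlocks_multiply]
  congr 1 <;> simp <;> abel

omit [Fintype n] in
theorem map_re_conjTranspose (U : Matrix n n ℂ) : Uᴴ.map Complex.re = (U.map Complex.re)ᵀ := by
  ext i j; simp

omit [Fintype n] in
theorem map_im_conjTranspose (U : Matrix n n ℂ) : Uᴴ.map Complex.im = -(U.map Complex.im)ᵀ := by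
  ext i j; simp

variable [DecidableEq n]

omit [Fintype n] in
theorem map_re_one : (1 : Matrix n n ℂ).map Complex.re = 1 := by
  ext i j; by_cases h : i = j <;> simp [one_apply, h]

omit [Fintype n] in
theorem map_im_one : (1 : Matrix n n ℂ).map Complex.im = 0 := by
  ext i j; by_cases h : i = j <;> simp [one_apply, h]

/-- The standard symplectic matrix `(0, I; -I, 0)`. -/
def symplJ (n : Type) [DecidableEq n] : Matrix (n ⊕ n) (n ⊕ n) ℝ := fromBlocks 0 1 (-1) 0

/-- A unitary matrix with invertible imaginary part gives a free symplectic matrix. -/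
theorem symplR_eq_of_isUnit_im {U : Matrix n n ℂ} (hU : U ∈ unitaryGroup n ℂ)
    (h : IsUnit (U.map Complex.im).det) :
    ∃ P P' : Matrix n n ℝ, Pᵀ = P ∧ P'ᵀ = P' ∧
      symplR U = symplV P * symplD (U.map Complex.im) * symplJ n * symplV P' := by
  have h1 : Uᴴ * U = 1 := mem_unitaryGroup_iff'.1 hU
  have h2 : U * Uᴴ = 1 := mem_unitaryGroup_iff.1 hU
  have a1 := congrArg (fun M => M.map Complex.re) h1
  have a2 := congrArg (fun M => M.map Complex.im) h1
  have a3 := congrArg (fun M => M.map Complex.im) h2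
  simp only [map_re_mul, map_im_mul, map_re_conjTranspose, map_im_conjTranspose, map_re_one,
    map_im_one] at a1 a2 a3
  simp only [symplR]
  set A := U.map Complex.re
  set B := U.map Complex.im
  have hBt : IsUnit Bᵀ.det := by rwa [det_transpose]
  -- Real and imaginary parts of `Uᴴ * U = 1`, and the imaginary part of `U * Uᴴ = 1`. The last two
  -- make `B⁻¹ * A` and `A * B⁻¹` symmetric.
  have e1 : Aᵀ * A - 1 = -(Bᵀ * B) := by rw [← a1]; simp
  have e2 : Bᵀ * A = Aᵀ * B := by
    rw [← sub_eq_zero, ← neg_eq_zero, ← a2]; simp; abel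
  have e3 : A * Bᵀ = B * Aᵀ := by
    rw [← sub_eq_zero, ← neg_eq_zero, ← a3]; simp; abel
  have s1 : (Bᵀ)⁻¹ * Aᵀ = A * B⁻¹ := by
    rw [← mul_nonsing_inv_cancel_right B Aᵀ h, ← e2, Matrix.mul_assoc,
      nonsing_inv_mul_cancel_left _ _ hBt]
  have s2 : Aᵀ * (Bᵀ)⁻¹ = B⁻¹ * A := by
    rw [← nonsing_inv_mul_cancel_left B Aᵀ h, ← e3, Matrix.mul_assoc, Matrix.mul_assoc,
      mul_nonsing_inv _ hBt, Matrix.mul_one]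
  refine ⟨A * B⁻¹, B⁻¹ * A, ?_, ?_, ?_⟩
  · rw [transpose_mul, transpose_nonsing_inv, s1]
  · rw [transpose_mul, transpose_nonsing_inv, s2]
  · simp only [symplV, symplD, symplJ, fromBlocks_multiply]
    have c1 : A * B⁻¹ * B = A := nonsing_inv_mul_cancel_right _ _ h
    have c2 : B * (B⁻¹ * A) = A := mul_nonsing_inv_cancel_left _ _ h
    have c3 : A * (B⁻¹ * A) - (Bᵀ)⁻¹ = -B := by
      rw [← Matrix.mul_assoc, ← s1, Matrix.mul_assoc]
      have : (Bᵀ)⁻¹ * (Aᵀ * A) - (Bᵀ)⁻¹ = (Bᵀ)⁻¹ * (Aᵀ * A - 1) := by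
        rw [Matrix.mul_sub, Matrix.mul_one]
      rw [this, e1, Matrix.mul_neg, nonsing_inv_mul_cancel_left _ _ hBt]
    congr 1
    · simp [c2]
    · simp
    · simp [c1]; rw [← c3]; abel
    · simp [c1]

theorem exists_isUnit_im_smul {U : Matrix n n ℂ} (hU : U ∈ unitaryGroup n ℂ) :
    ∃ z : ℂ, z * star z = 1 ∧ z.im ≠ 0 ∧ IsUnit ((z • U).map Complex.im).det := by
  set A := U.map Complex.re with hA
  set B := U.map Complex.im with hB
  -- `det (t A + B)` is a polynomial in `t`, non-zero because its value at `t = -i` is `det (-i U)`.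
  -- For real `t`, `t A + B` is the imaginary part of `(1 + t i) U`.
  let p : Polynomial ℝ :=
    det ((Polynomial.X : Polynomial ℝ) • A.map Polynomial.C + B.map Polynomial.C)
  have hev (t : ℝ) : p.eval t = (t • A + B).det := by
    rw [← Polynomial.coe_evalRingHom, RingHom.map_det]
    congr 1
    ext i j
    simp
    ring
  have hp : p ≠ 0 := by
    intro h0
    have h1 : Polynomial.eval₂RingHom Complex.ofRealHom (-Complex.I) p =
        ((-Complex.I) • U).det := by
      rw [RingHom.map_det]
      congr 1
      ext i j
      apply Complex.ext <;> simp [hA, hB]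
    rw [h0, map_zero, det_smul, eq_comm, mul_eq_zero] at h1
    rcases h1 with h1 | h1
    · exact pow_ne_zero _ (neg_ne_zero.2 Complex.I_ne_zero) h1
    · have := congrArg det (mem_unitaryGroup_iff.1 hU)
      rw [det_mul, h1, zero_mul, det_one] at this
      exact zero_ne_one this
  -- The factor `X` also excludes `t = 0`, so that `z` is not real.
  obtain ⟨t, ht⟩ : ∃ t, t ∉ (p * Polynomial.X).roots.toFinset := Infinite.exists_notMem_finset _
  have ht' : p.eval t ≠ 0 ∧ t ≠ 0 := by
    simpa [hp, not_or] using ht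
  have hz : (1 + t * Complex.I : ℂ) * star (1 + t * Complex.I : ℂ) = ((1 + t ^ 2 : ℝ) : ℂ) := by
    apply Complex.ext <;> simp <;> ring_nf <;> simp [← Complex.ofReal_pow]
  have hpos : 0 < 1 + t ^ 2 := by positivity
  set s : ℝ := (Real.sqrt (1 + t ^ 2))⁻¹ with hs
  have hs0 : s ≠ 0 := by positivity
  have hss : s * s * (1 + t ^ 2) = 1 := by
    rw [hs, ← mul_inv, Real.mul_self_sqrt hpos.le, inv_mul_cancel₀ hpos.ne']
  refine ⟨s * (1 + t * Complex.I), ?_, ?_, ?_⟩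
  · rw [star_mul', mul_mul_mul_comm, hz]
    simp only [Complex.star_def, Complex.conj_ofReal]
    exact_mod_cast hss
  · simp [hs0, ht'.2]
  · have : (((s : ℂ) * (1 + t * Complex.I)) • U).map Complex.im = s • (t • A + B) := by
      ext i j
      simp [hA, hB]
      ring
    rw [this, det_smul, ← hev, isUnit_iff_ne_zero]
    exact mul_ne_zero (pow_ne_zero _ hs0) ht'.1

theorem transpose_aeval (q : Polynomial ℂ) (U : Matrix n n ℂ) :
    (Polynomial.aeval U q)ᵀ = Polynomial.aeval Uᵀ q := by
  induction q using Polynomial.induction_on' with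
  | add p q hp hq => simp [hp, hq]
  | monomial k a => simp [Polynomial.aeval_monomial, transpose_pow, Algebra.algebraMap_eq_smul_one]

open Matrix.Norms.L2Operator in
/-- A symmetric unitary matrix has a symmetric unitary square root. -/
theorem exists_symm_unitary_sqrt {U : Matrix n n ℂ} (hU : U ∈ unitaryGroup n ℂ) (hs : Uᵀ = U) :
    ∃ V ∈ unitaryGroup n ℂ, Vᵀ = V ∧ V * V = U := by
  have hU' : U ∈ unitary (Matrix n n ℂ) := hU
  have hn : IsStarNormal U := ⟨by
    rw [Commute, SemiconjBy, (Unitary.mem_iff.1 hU').1, (Unitary.mem_iff.1 hU').2]⟩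
  -- A square root on the unit circle, which contains the spectrum. Interpolating it by a polynomial
  -- `q` makes `q(U)` inherit the symmetry of `U`.
  let f : ℂ → ℂ := fun z => Complex.exp ((z.arg / 2 : ℝ) * Complex.I)
  let t := (Matrix.finite_spectrum (R := ℂ) U).toFinset
  let q := Lagrange.interpolate t id f
  have hq : ∀ x ∈ spectrum ℂ U, q.eval x = f x := fun x hx =>
    Lagrange.eval_interpolate_at_node (v := id) f Function.injective_id.injOn
      ((Matrix.finite_spectrum (R := ℂ) U).mem_toFinset.2 hx)
  refine ⟨Polynomial.aeval U q, ?_, ?_, ?_⟩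
  · rw [← cfc_polynomial q U]
    refine (cfc_unitary_iff _ U).2 fun x hx => ?_
    rw [hq x hx, Complex.star_def, ← Complex.normSq_eq_conj_mul_self, Complex.normSq_eq_norm_sq,
      Complex.norm_exp_ofReal_mul_I]
    simp
  · rw [transpose_aeval, hs]
  · rw [← map_mul, ← cfc_polynomial (q * q) U]
    conv_rhs => rw [← cfc_id ℂ U]
    refine cfc_congr fun x hx => ?_
    have hx1 : ‖x‖ = 1 := by
      simpa using spectrum.subset_circle_of_unitary hU' hx
    have := Complex.norm_mul_exp_arg_mul_I x
    rw [hx1, Complex.ofReal_one, one_mul] at this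
    simp only [Polynomial.eval_mul, hq x hx, id, f]
    rw [← Complex.exp_add]
    convert this using 2
    push_cast
    ring

end SymplecticMatrices

/-! ### Covariance of weighted composition operators and of the Fourier transform. -/

section Operators

open scoped ENNReal

variable {ι : Type} [Fintype ι]

local notation "E" => EuclideanSpace ℝ ι

theorem tfShift_coeFn (x ω : E) (f : L2 ι) : tfShift x ω f =ᵐ[volume] tfShiftFun x ω f :=
  MemLp.coeFn_toLp _

/-- The scalar factor of the time-frequency shift. -/
def tfFactor (x ω t : E) : ℂ :=
  Complex.exp (((-(Real.pi * inner ℝ x ω) : ℝ) : ℂ) * Complex.I) *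
    Complex.exp (((2 * Real.pi * inner ℝ ω t : ℝ) : ℂ) * Complex.I)

theorem tfShiftFun_apply (x ω : E) (f : E → ℂ) (t : E) :
    tfShiftFun x ω f t = tfFactor x ω t * f (t - x) := rfl

theorem isMetaplectic_iff {A : Matrix (ι ⊕ ι) (ι ⊕ ι) ℝ} {T : L2 ι ≃ₗᵢ[ℂ] L2 ι} :
    IsMetaplectic A T ↔
      ∀ (l : ι ⊕ ι → ℝ) (f : L2 ι), phaseShift (A *ᵥ l) (T f) = T (phaseShift l f) := by
  refine ⟨fun h l f => ?_, fun h l f => ?_⟩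
  · rw [h, T.symm_apply_apply]
  · rw [← h, T.apply_symm_apply]

theorem IsMetaplectic.mul {A B : Matrix (ι ⊕ ι) (ι ⊕ ι) ℝ} {S T : L2 ι ≃ₗᵢ[ℂ] L2 ι}
    (hS : IsMetaplectic A S) (hT : IsMetaplectic B T) : IsMetaplectic (A * B) (T.trans S) := by
  rw [isMetaplectic_iff] at *
  intro l f
  rw [← mulVec_mulVec, LinearIsometryEquiv.trans_apply, hS, hT, LinearIsometryEquiv.trans_apply]

theorem eLpNorm_weightedComp {m : E → ℂ} {Φ : E ≃ᵐ E} {r : ℝ} (hr : 0 < r) (hm : ∀ t, ‖m t‖ = r)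
    (hΦ : Measure.map Φ volume = ENNReal.ofReal (r⁻¹ ^ 2) • volume) (f : E → ℂ) :
    eLpNorm (fun t => m t * f (Φ t)) 2 volume = eLpNorm f 2 volume := by
  have h1 : eLpNorm (fun t => m t * f (Φ t)) 2 volume =
      eLpNorm ((r : ℂ) • fun t => f (Φ t)) 2 volume :=
    eLpNorm_congr_norm_ae (.of_forall fun t => by simp [hm, abs_of_pos hr])
  have h2 : eLpNorm (fun t => f (Φ t)) 2 volume = eLpNorm f 2 (Measure.map Φ volume) :=
    (Φ.measurableEmbedding.eLpNorm_map_measure).symm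
  have h3 : ENNReal.ofReal (r⁻¹ ^ 2) ≠ 0 := by
    rw [Ne, ENNReal.ofReal_eq_zero, not_le]; positivity
  rw [h1, eLpNorm_const_smul, h2, hΦ, eLpNorm_smul_measure_of_ne_zero h3, smul_eq_mul, ← mul_assoc,
    ENNReal.ofReal_rpow_of_pos (by positivity), ← ofReal_norm, ← ENNReal.ofReal_mul (norm_nonneg _)]
  have h4 : ‖(r : ℂ)‖ * (r⁻¹ ^ 2) ^ (1 / (2 : ℝ≥0∞)).toReal = 1 := by
    rw [← Real.rpow_natCast, ← Real.rpow_mul (by positivity)]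
    simp [abs_of_pos hr, hr.ne']
  rw [h4, ENNReal.ofReal_one, one_mul]

theorem map_symm_weightedComp {Φ : E ≃ᵐ E} {r : ℝ} (hr : 0 < r)
    (hΦ : Measure.map Φ volume = ENNReal.ofReal (r⁻¹ ^ 2) • volume) :
    Measure.map Φ.symm (volume : Measure E) = ENNReal.ofReal ((r⁻¹)⁻¹ ^ 2) • volume := by
  have h : (volume : Measure E) = ENNReal.ofReal ((r⁻¹)⁻¹ ^ 2) • Measure.map Φ volume := by
    rw [hΦ, smul_smul, ← ENNReal.ofReal_mul (by positivity)]
    have : (r⁻¹)⁻¹ ^ 2 * r⁻¹ ^ 2 = 1 := by field_simp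
    rw [this, ENNReal.ofReal_one, one_smul]
  conv_lhs => rw [h]
  rw [Measure.map_smul, Φ.map_symm_map]

/-- Weighted composition operators are unitary when the weight compensates the Jacobian. -/
theorem exists_weightedComp {m : E → ℂ} {Φ : E ≃ᵐ E} {r : ℝ} (hr : 0 < r) (hm : ∀ t, ‖m t‖ = r)
    (hmm : Measurable m) (hΦ : Measure.map Φ volume = ENNReal.ofReal (r⁻¹ ^ 2) • volume) :
    ∃ T : L2 ι ≃ₗᵢ[ℂ] L2 ι, ∀ f, T f =ᵐ[volume] fun t => m t * f (Φ t) := by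
  have qmp {Ψ : E ≃ᵐ E} {s : ℝ}
      (h : Measure.map Ψ volume = ENNReal.ofReal (s⁻¹ ^ 2) • volume) :
      Measure.QuasiMeasurePreserving Ψ volume volume :=
    ⟨Ψ.measurable, by rw [h]; exact Measure.smul_absolutelyContinuous⟩
  have mem {w : E → ℂ} {Ψ : E ≃ᵐ E} {s : ℝ} (hs : 0 < s) (hw : ∀ t, ‖w t‖ = s) (hwm : Measurable w)
      (h : Measure.map Ψ volume = ENNReal.ofReal (s⁻¹ ^ 2) • volume) (f : L2 ι) :
      MemLp (fun t => w t * f (Ψ t)) 2 volume :=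
    ⟨hwm.aestronglyMeasurable.mul
      ((Lp.aestronglyMeasurable f).comp_quasiMeasurePreserving (qmp h)), by
        rw [eLpNorm_weightedComp hs hw h]; exact (Lp.memLp f).2⟩
  have hm0 (t : E) : m t ≠ 0 := norm_ne_zero_iff.1 (by rw [hm]; exact hr.ne')
  have hΦ' := map_symm_weightedComp hr hΦ
  let S : L2 ι →ₗᵢ[ℂ] L2 ι :=
    { toFun := fun f => (mem hr hm hmm hΦ f).toLp _
      map_add' := fun f g => by
        apply Lp.ext
        filter_upwards [MemLp.coeFn_toLp (mem hr hm hmm hΦ (f + g)),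
          MemLp.coeFn_toLp (mem hr hm hmm hΦ f), MemLp.coeFn_toLp (mem hr hm hmm hΦ g),
          Lp.coeFn_add ((mem hr hm hmm hΦ f).toLp _) ((mem hr hm hmm hΦ g).toLp _),
          (qmp hΦ).ae (Lp.coeFn_add f g)] with t h1 h2 h3 h4 h5
        rw [h1, h4, Pi.add_apply, h2, h3, h5, Pi.add_apply, mul_add]
      map_smul' := fun c f => by
        apply Lp.ext
        filter_upwards [MemLp.coeFn_toLp (mem hr hm hmm hΦ (c • f)),
          MemLp.coeFn_toLp (mem hr hm hmm hΦ f),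
          Lp.coeFn_smul c ((mem hr hm hmm hΦ f).toLp _),
          (qmp hΦ).ae (Lp.coeFn_smul c f)] with t h1 h2 h3 h4
        rw [h1, RingHom.id_apply, h3, Pi.smul_apply, h2, h4, Pi.smul_apply, smul_eq_mul,
          smul_eq_mul, mul_left_comm]
      norm_map' := fun f => by
        change ‖(mem hr hm hmm hΦ f).toLp _‖ = _
        rw [Lp.norm_toLp, eLpNorm_weightedComp hr hm hΦ, Lp.norm_def] }
  have hS : Function.Surjective S := fun g => by
    have hg := mem (w := fun t => (m (Φ.symm t))⁻¹) (inv_pos.2 hr) (fun t => by rw [norm_inv, hm])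
      (hmm.comp Φ.symm.measurable).inv hΦ' g
    refine ⟨hg.toLp _, Lp.ext ?_⟩
    filter_upwards [MemLp.coeFn_toLp (mem hr hm hmm hΦ (hg.toLp _)),
      (qmp hΦ).ae (MemLp.coeFn_toLp hg)] with t h1 h2
    refine h1.trans ?_
    rw [h2, Φ.symm_apply_apply, mul_inv_cancel_left₀ (hm0 t)]
  exact ⟨LinearIsometryEquiv.ofSurjective S hS, fun f => MemLp.coeFn_toLp (mem hr hm hmm hΦ f)⟩

theorem continuous_tfFactor (x ω : E) : Continuous (tfFactor x ω) := by
  unfold tfFactor; fun_prop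

theorem norm_tfFactor (x ω t : E) : ‖tfFactor x ω t‖ = 1 := by
  simp only [tfFactor, norm_mul, Complex.norm_exp_ofReal_mul_I, one_mul]

/-- Lets the covariance of the Fourier transform extend from Schwartz functions by density. -/
theorem continuous_tfShift (x ω : E) : Continuous (tfShift x ω : L2 ι → L2 ι) := by
  obtain ⟨T, hT⟩ := exists_weightedComp (m := tfFactor x ω) (Φ := MeasurableEquiv.subRight x)
    one_pos (norm_tfFactor x ω) (continuous_tfFactor x ω).measurable
    (by simpa using! (measurePreserving_sub_right volume x).map_eq)
  have : (tfShift x ω : L2 ι → L2 ι) = T :=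
    funext fun f => Lp.ext ((tfShift_coeFn x ω f).trans (hT f).symm)
  rw [this]
  exact T.continuous

/-- Reduces covariance to two pointwise identities, one for the translation and one for the scalar
factors. -/
theorem tfShift_weightedComp {m : E → ℂ} {Φ : E ≃ᵐ E} {r : ℝ}
    (hΦ : Measure.map Φ volume = ENNReal.ofReal (r⁻¹ ^ 2) • volume)
    {T : L2 ι ≃ₗᵢ[ℂ] L2 ι} (hT : ∀ f, T f =ᵐ[volume] fun t => m t * f (Φ t)) {x ω x' ω' : E}
    (h1 : ∀ t, Φ (t - x') = Φ t - x)
    (h2 : ∀ t, tfFactor x' ω' t * m (t - x') = m t * tfFactor x ω (Φ t)) (f : L2 ι) :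
    tfShift x' ω' (T f) = T (tfShift x ω f) := by
  apply Lp.ext
  have q : Measure.QuasiMeasurePreserving Φ volume volume :=
    ⟨Φ.measurable, by rw [hΦ]; exact Measure.smul_absolutelyContinuous⟩
  filter_upwards [tfShift_coeFn x' ω' (T f), hT (tfShift x ω f),
    (measurePreserving_sub_right volume x').quasiMeasurePreserving.ae (hT f),
    q.ae (tfShift_coeFn x ω f)] with t e1 e2 e3 e4
  rw [e1, e2, e4, tfShiftFun_apply, e3, tfShiftFun_apply, h1, ← mul_assoc, h2, mul_assoc]

open FourierTransform SchwartzMap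

theorem hasTemperateGrowth_exp_ofReal_mul_I :
    (fun t : ℝ => Complex.exp (t * Complex.I)).HasTemperateGrowth := by
  have hd (n : ℕ) : iteratedDeriv n (fun t : ℝ => Complex.exp (t * Complex.I)) =
      fun t : ℝ => Complex.I ^ n * Complex.exp (t * Complex.I) := by
    induction n with
    | zero => simp
    | succ n ih =>
      rw [iteratedDeriv_succ, ih]
      ext t
      have h : HasDerivAt (fun t : ℝ => Complex.I ^ n * Complex.exp (t * Complex.I))
          (Complex.I ^ n * (Complex.exp (t * Complex.I) * (1 * Complex.I))) t :=
        (((Complex.ofRealCLM.hasDerivAt (x := t)).mul_const _).cexp).const_mul _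
      rw [h.deriv]
      ring
  refine ⟨(Complex.ofRealCLM.contDiff.mul contDiff_const).cexp, fun n => ⟨0, 1, fun t => ?_⟩⟩
  rw [norm_iteratedFDeriv_eq_norm_iteratedDeriv, hd]
  simp [Complex.norm_exp_ofReal_mul_I]

theorem hasTemperateGrowth_tfFactor (x ω : E) : (tfFactor x ω).HasTemperateGrowth := by
  refine (Function.HasTemperateGrowth.const _).mul
    (hasTemperateGrowth_exp_ofReal_mul_I.comp ?_)
  fun_prop

/-- The time-frequency shift on Schwartz functions. -/
def tfShiftSchwartz (x ω : E) (f : 𝓢(E, ℂ)) : 𝓢(E, ℂ) :=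
  smulLeftCLM ℂ (tfFactor x ω) (f.compSubConstCLM ℂ x)

theorem tfShiftSchwartz_apply (x ω : E) (f : 𝓢(E, ℂ)) (t : E) :
    tfShiftSchwartz x ω f t = tfFactor x ω t * f (t - x) := by
  rw [tfShiftSchwartz, smulLeftCLM_apply_apply (hasTemperateGrowth_tfFactor x ω),
    compSubConstCLM_apply, smul_eq_mul]

theorem tfShift_toLp (x ω : E) (f : 𝓢(E, ℂ)) :
    tfShift x ω (f.toLp 2) = (tfShiftSchwartz x ω f).toLp 2 := by
  apply Lp.ext
  filter_upwards [tfShift_coeFn x ω (f.toLp 2), (tfShiftSchwartz x ω f).coeFn_toLp 2 volume,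
    (measurePreserving_sub_right volume x).quasiMeasurePreserving.ae (f.coeFn_toLp 2 volume)]
    with t h1 h2 h3
  rw [h1, h2, tfShiftSchwartz_apply, tfShiftFun_apply, h3]

/-- Translating the integration variable by `x` gives this; the symmetric normalisation `e^{-πi
x·ω}` is what leaves no extra scalar. -/
theorem fourier_tfShiftSchwartz (x ω : E) (f : 𝓢(E, ℂ)) :
    𝓕 (tfShiftSchwartz x ω f) = tfShiftSchwartz ω (-x) (𝓕 f) := by
  ext ξ
  rw [tfShiftSchwartz_apply, fourier_coe, fourier_coe, Real.fourier_eq', Real.fourier_eq',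
    ← integral_const_mul, ← integral_add_right_eq_self _ x]
  refine integral_congr_ae (.of_forall fun t => ?_)
  simp only [tfShiftSchwartz_apply, add_sub_cancel_right, smul_eq_mul, ← mul_assoc, tfFactor,
    ← Complex.exp_add, ← add_mul, ← Complex.ofReal_add]
  congr 4
  simp only [inner_add_left, inner_add_right, inner_sub_right, inner_neg_right, inner_neg_left,
    real_inner_comm ω x, real_inner_comm ω t]
  ring

theorem tfShift_fourier (x ω : E) (f : L2 ι) :
    tfShift ω (-x) (Lp.fourierTransformₗᵢ E ℂ f) =
      Lp.fourierTransformₗᵢ E ℂ (tfShift x ω f) := by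
  refine DenseRange.induction_on
    (p := fun f : L2 ι => tfShift ω (-x) (Lp.fourierTransformₗᵢ E ℂ f) =
      Lp.fourierTransformₗᵢ E ℂ (tfShift x ω f))
    (SchwartzMap.denseRange_toLpCLM (p := 2) ENNReal.ofNat_ne_top) f ?_ fun g => ?_
  · exact isClosed_eq ((continuous_tfShift _ _).comp (LinearIsometryEquiv.continuous _))
      ((LinearIsometryEquiv.continuous _).comp (continuous_tfShift _ _))
  · change tfShift ω (-x) (𝓕 (g.toLp 2)) = 𝓕 (tfShift x ω (g.toLp 2))
    rw [tfShift_toLp, toLp_fourier_eq, toLp_fourier_eq, tfShift_toLp, fourier_tfShiftSchwartz]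

end Operators

/-! ### Existence of metaplectic operators. -/

section Generators

variable {ι : Type} [Fintype ι]

theorem inner_toLp (x y : ι → ℝ) :
    inner ℝ (WithLp.toLp 2 x : EuclideanSpace ℝ ι) (WithLp.toLp 2 y) = x ⬝ᵥ y := by
  rw [EuclideanSpace.inner_toLp_toLp]; simp [dotProduct_comm]

variable [DecidableEq ι]

/-- Multiplication by the chirp `e^{πi t·Pt}`; symmetry of `P` cancels the cross terms. -/
theorem exists_isMetaplectic_symplV {P : Matrix ι ι ℝ} (hP : Pᵀ = P) :
    ∃ T : L2 ι ≃ₗᵢ[ℂ] L2 ι, IsMetaplectic (symplV P) T := by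
  let m : EuclideanSpace ℝ ι → ℂ := fun t =>
    Complex.exp (((Real.pi * (t.ofLp ⬝ᵥ P *ᵥ t.ofLp) : ℝ) : ℂ) * Complex.I)
  have hm : Continuous m := by
    refine Complex.continuous_exp.comp ((Complex.continuous_ofReal.comp
      (continuous_const.mul ?_)).mul continuous_const)
    have h : Continuous fun t : EuclideanSpace ℝ ι => t.ofLp := PiLp.continuous_ofLp 2 _
    exact h.dotProduct (continuous_const.matrix_mulVec h)
  have hΦ : Measure.map (MeasurableEquiv.refl (EuclideanSpace ℝ ι)) volume =
      ENNReal.ofReal ((1 : ℝ)⁻¹ ^ 2) • volume := by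
    rw [inv_one, one_pow, ENNReal.ofReal_one, one_smul]
    exact Measure.map_id
  obtain ⟨T, hT⟩ := exists_weightedComp (m := m) (Φ := MeasurableEquiv.refl _) one_pos
    (fun t => Complex.norm_exp_ofReal_mul_I _) hm.measurable hΦ
  refine ⟨T, isMetaplectic_iff.2 fun l f => tfShift_weightedComp hΦ hT ?_ ?_ f⟩
  · intro t
    ext i
    simp [symplV, fromBlocks_mulVec]
  · intro t
    simp only [tfFactor, m, MeasurableEquiv.refl_apply, ← Complex.exp_add, ← add_mul,
      ← Complex.ofReal_add]
    congr 3
    obtain ⟨s⟩ := t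
    have hs (u v : ι → ℝ) : P *ᵥ u ⬝ᵥ v = u ⬝ᵥ P *ᵥ v := by
      rw [dotProduct_mulVec, ← mulVec_transpose, hP]
    set x := fun i => l (Sum.inl i) with hx
    set ω := fun i => l (Sum.inr i) with hω
    have e1 : (fun i => (symplV P *ᵥ l) (Sum.inl i)) = x := by
      ext i; simp [symplV, fromBlocks_mulVec, hx]
    have e2 : (fun i => (symplV P *ᵥ l) (Sum.inr i)) = ω + P *ᵥ x := by
      ext i; simp [symplV, fromBlocks_mulVec, hx, hω, Function.comp_def, add_comm]
    rw [e1, e2]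
    simp only [← WithLp.toLp_sub, inner_toLp, mulVec_sub, sub_dotProduct, dotProduct_sub,
      dotProduct_add, add_dotProduct, hs]
    rw [← hs s x, dotProduct_comm (P *ᵥ s) x]
    ring

theorem exists_isMetaplectic_symplD {L : Matrix ι ι ℝ} (hL : IsUnit L.det) :
    ∃ T : L2 ι ≃ₗᵢ[ℂ] L2 ι, IsMetaplectic (symplD L) T := by
  have hdet : LinearMap.det (toEuclideanLin L⁻¹) ≠ 0 := by
    rw [toEuclideanLin, LinearMap.det_toLpLin]
    exact ((isUnit_nonsing_inv_det_iff).2 hL).ne_zero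
  let Φ : EuclideanSpace ℝ ι ≃ᵐ EuclideanSpace ℝ ι :=
    (LinearMap.equivOfDetNeZero _ hdet).toContinuousLinearEquiv.toHomeomorph.toMeasurableEquiv
  have hΦa (t : EuclideanSpace ℝ ι) : Φ t = toEuclideanLin L⁻¹ t := rfl
  -- Unitary normalisation of `f ↦ f ∘ L⁻¹`: `r²` is the Jacobian of `L⁻¹`.
  set r := Real.sqrt |LinearMap.det (toEuclideanLin L⁻¹)|
  have hr : 0 < r := Real.sqrt_pos.2 (abs_pos.2 hdet)
  have hΦ : Measure.map Φ volume = ENNReal.ofReal (r⁻¹ ^ 2) • volume := by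
    have := Measure.map_linearMap_addHaar_eq_smul_addHaar volume hdet
    rw [abs_inv, ← Real.sq_sqrt (abs_nonneg (LinearMap.det _)), ← inv_pow] at this
    exact this
  obtain ⟨T, hT⟩ := exists_weightedComp (m := fun _ => (r : ℂ)) hr
    (fun t => by simp [abs_of_pos hr]) measurable_const hΦ
  refine ⟨T, isMetaplectic_iff.2 fun l f => tfShift_weightedComp hΦ hT ?_ ?_ f⟩
  all_goals
    set x := fun i => l (Sum.inl i) with hx
    set ω := fun i => l (Sum.inr i) with hω
    have e1 : (fun i => (symplD L *ᵥ l) (Sum.inl i)) = L *ᵥ x := by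
      ext i; simp [symplD, fromBlocks_mulVec, hx, Function.comp_def]
    have e2 : (fun i => (symplD L *ᵥ l) (Sum.inr i)) = (Lᵀ)⁻¹ *ᵥ ω := by
      ext i; simp [symplD, fromBlocks_mulVec, hω, Function.comp_def]
    have e3 : L⁻¹ *ᵥ L *ᵥ x = x := by rw [mulVec_mulVec, nonsing_inv_mul _ hL, one_mulVec]
    rintro ⟨t⟩
    rw [e1]
  · rw [hΦa, hΦa, map_sub, toLpLin_toLp, toLpLin_toLp, toLin'_apply, toLin'_apply, e3]
  · have e4 (u v : ι → ℝ) : (Lᵀ)⁻¹ *ᵥ u ⬝ᵥ v = u ⬝ᵥ L⁻¹ *ᵥ v := by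
      rw [← transpose_nonsing_inv, mulVec_transpose, ← dotProduct_mulVec]
    rw [e2, mul_comm (r : ℂ), hΦa, toLpLin_toLp, toLin'_apply]
    simp only [tfFactor, inner_toLp]
    rw [dotProduct_comm (L *ᵥ x), e4, e4, e3, dotProduct_comm ω x]

theorem exists_isMetaplectic_symplJ :
    ∃ T : L2 ι ≃ₗᵢ[ℂ] L2 ι, IsMetaplectic (symplJ ι) T := by
  refine ⟨Lp.fourierTransformₗᵢ _ ℂ, isMetaplectic_iff.2 fun l f => ?_⟩
  have e1 : (WithLp.toLp 2 fun i => (symplJ ι *ᵥ l) (Sum.inl i) : EuclideanSpace ℝ ι) =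
      WithLp.toLp 2 fun i => l (Sum.inr i) := by
    ext i; simp [symplJ, fromBlocks_mulVec]
  have e2 : (WithLp.toLp 2 fun i => (symplJ ι *ᵥ l) (Sum.inr i) : EuclideanSpace ℝ ι) =
      -WithLp.toLp 2 fun i => l (Sum.inl i) := by
    ext i; simp [symplJ, fromBlocks_mulVec, neg_mulVec]
  simp only [phaseShift, e1, e2]
  exact tfShift_fourier _ _ f

theorem exists_isMetaplectic_symplR_of_isUnit_im {U : Matrix ι ι ℂ} (hU : U ∈ unitaryGroup ι ℂ)
    (h : IsUnit (U.map Complex.im).det) :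
    ∃ T : L2 ι ≃ₗᵢ[ℂ] L2 ι, IsMetaplectic (symplR U) T := by
  obtain ⟨P, P', hP, hP', e⟩ := symplR_eq_of_isUnit_im hU h
  obtain ⟨T₁, h₁⟩ := exists_isMetaplectic_symplV hP
  obtain ⟨T₂, h₂⟩ := exists_isMetaplectic_symplD h
  obtain ⟨T₃, h₃⟩ := exists_isMetaplectic_symplJ (ι := ι)
  obtain ⟨T₄, h₄⟩ := exists_isMetaplectic_symplV hP'
  exact ⟨_, e ▸ ((h₁.mul h₂).mul h₃).mul h₄⟩

/-- Splits `U = (z U)(z̄ I)` with `|z| = 1`, chosen so that both factors have invertible imaginary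
part. -/
theorem exists_isMetaplectic_symplR {U : Matrix ι ι ℂ} (hU : U ∈ unitaryGroup ι ℂ) :
    ∃ T : L2 ι ≃ₗᵢ[ℂ] L2 ι, IsMetaplectic (symplR U) T := by
  obtain ⟨z, hz, hz0, h⟩ := exists_isUnit_im_smul hU
  have key (w : ℂ) (hw : w * star w = 1) {W : Matrix ι ι ℂ} (hW : W ∈ unitaryGroup ι ℂ) :
      w • W ∈ unitaryGroup ι ℂ := by
    rw [mem_unitaryGroup_iff] at *
    rw [star_smul, smul_mul_smul_comm, hw, hW, one_smul]
  obtain ⟨T₁, h₁⟩ := exists_isMetaplectic_symplR_of_isUnit_im (key z hz hU) h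
  obtain ⟨T₂, h₂⟩ := exists_isMetaplectic_symplR_of_isUnit_im
    (key (star z) (by rw [star_star, mul_comm, hz]) (one_mem (unitaryGroup ι ℂ))) (by
      have : (star z • (1 : Matrix ι ι ℂ)).map Complex.im = (-z.im) • (1 : Matrix ι ι ℝ) := by
        ext i j; by_cases hij : i = j <;> simp [one_apply, hij]
      rw [this, det_smul, det_one, mul_one, isUnit_iff_ne_zero]
      exact pow_ne_zero _ (neg_ne_zero.2 hz0))
  have e : symplR U = symplR (z • U) * symplR (star z • (1 : Matrix ι ι ℂ)) := by
    rw [← symplR_mul, smul_mul_smul_comm, hz, one_smul, Matrix.mul_one]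
  exact ⟨_, e ▸ h₁.mul h₂⟩

end Generators

/-! ### The block factorization and tensor products. -/

section Block

theorem symplR_one {n : Type} [Fintype n] [DecidableEq n] : symplR (1 : Matrix n n ℂ) = 1 := by
  rw [symplR, map_re_one, map_im_one, neg_zero, fromBlocks_one]

theorem symplD_mul {n : Type} [Fintype n] [DecidableEq n] (L M : Matrix n n ℝ) :
    symplD (L * M) = symplD L * symplD M := by
  simp [symplD, fromBlocks_multiply, Matrix.mul_inv_rev]

theorem symplR_conjTranspose_mulVec {n : Type} [Fintype n] [DecidableEq n] {V : Matrix n n ℂ}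
    (hV : V ∈ unitaryGroup n ℂ) (l : n ⊕ n → ℝ) : symplR V *ᵥ symplR Vᴴ *ᵥ l = l := by
  rw [mulVec_mulVec, ← symplR_mul, ← star_eq_conjTranspose, mem_unitaryGroup_iff.1 hV, symplR_one,
    one_mulVec]

/-- A unitary matrix `W` with `Wᵗ W = 1` is real orthogonal. -/
theorem symplR_eq_symplD {n : Type} [Fintype n] [DecidableEq n] {W : Matrix n n ℂ}
    (hW : W ∈ unitaryGroup n ℂ) (h : Wᵀ * W = 1) :
    ∃ M : Matrix n n ℝ, IsUnit M.det ∧ symplR W = symplD M := by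
  have h1 : Wᵀ = Wᴴ := by
    have h2 := mem_unitaryGroup_iff.1 hW
    rw [star_eq_conjTranspose] at h2
    rw [← Matrix.mul_one Wᵀ, ← h2, ← Matrix.mul_assoc, h, Matrix.one_mul]
  have him : W.map Complex.im = 0 := by
    ext i j
    have := congrArg Complex.im (congrFun (congrFun h1 j) i)
    simp only [transpose_apply, conjTranspose_apply, Complex.star_def, Complex.conj_im] at this
    simp only [map_apply, Matrix.zero_apply]
    linarith
  have hre : (W.map Complex.re)ᵀ * W.map Complex.re = 1 := by
    have := congrArg (fun M => M.map Complex.re) h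
    simp only [map_re_mul, map_re_one, him, Matrix.mul_zero, sub_zero] at this
    exact this
  refine ⟨W.map Complex.re, ?_, ?_⟩
  · exact (isUnit_iff_isUnit_det _).1 (.of_mul_eq_one_right _ hre)
  · rw [symplR, symplD, him, neg_zero, inv_eq_right_inv hre]

/-- Both blocks of `Uᵀ * U` are symmetric and unitary; with `V` the block-diagonal symmetric square
root, `W = U * Vᴴ` has `Wᵀ * W = 1`, hence is real. -/
theorem exists_block_factor {ι κ : Type} [Fintype ι] [Fintype κ] [DecidableEq ι] [DecidableEq κ]
    {U : Matrix (ι ⊕ κ) (ι ⊕ κ) ℂ} (hU : U ∈ unitaryGroup (ι ⊕ κ) ℂ) {U₁ : Matrix ι ι ℂ}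
    {U₂ : Matrix κ κ ℂ} (h : Uᵀ * U = fromBlocks U₁ 0 0 U₂) :
    ∃ V₁ ∈ unitaryGroup ι ℂ, ∃ V₂ ∈ unitaryGroup κ ℂ, ∃ M : Matrix (ι ⊕ κ) (ι ⊕ κ) ℝ,
      IsUnit M.det ∧ symplR U * symplR (fromBlocks V₁ᴴ 0 0 V₂ᴴ) = symplD M := by
  have hs : (Uᵀ * U)ᵀ = Uᵀ * U := by rw [transpose_mul, transpose_transpose]
  have hUt : Uᵀ ∈ unitaryGroup (ι ⊕ κ) ℂ := by
    have h1 := mem_unitaryGroup_iff'.1 hU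
    rw [star_eq_conjTranspose] at h1
    rw [mem_unitaryGroup_iff, star_eq_conjTranspose, conjTranspose_transpose_eq_transpose_conjTranspose,
      ← transpose_mul, h1, transpose_one]
  have hu := mem_unitaryGroup_iff.1 (mul_mem hUt hU)
  rw [h, fromBlocks_transpose, fromBlocks_inj] at hs
  rw [h, star_eq_conjTranspose, fromBlocks_conjTranspose, fromBlocks_multiply, ← fromBlocks_one,
    fromBlocks_inj] at hu
  simp only [Matrix.mul_zero, Matrix.zero_mul, add_zero, zero_add, conjTranspose_zero] at hu
  obtain ⟨V₁, hV₁, hV₁s, hV₁m⟩ := exists_symm_unitary_sqrt (mem_unitaryGroup_iff.2 hu.1) hs.1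
  obtain ⟨V₂, hV₂, hV₂s, hV₂m⟩ := exists_symm_unitary_sqrt (mem_unitaryGroup_iff.2 hu.2.2.2) hs.2.2.2
  set V : Matrix (ι ⊕ κ) (ι ⊕ κ) ℂ := fromBlocks V₁ 0 0 V₂ with hV
  have hVH : fromBlocks V₁ᴴ 0 0 V₂ᴴ = Vᴴ := by simp [hV, fromBlocks_conjTranspose]
  have hVs : Vᵀ = V := by simp [hV, fromBlocks_transpose, hV₁s, hV₂s]
  have hVV : V * V = Uᵀ * U := by simp [hV, fromBlocks_multiply, hV₁m, hV₂m, h]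
  have hVu : V * Vᴴ = 1 := by
    have e1 := mem_unitaryGroup_iff.1 hV₁
    have e2 := mem_unitaryGroup_iff.1 hV₂
    rw [star_eq_conjTranspose] at e1 e2
    simp [hV, fromBlocks_conjTranspose, fromBlocks_multiply, e1, e2]
  have hVm : Vᴴ ∈ unitaryGroup (ι ⊕ κ) ℂ := by
    rw [mem_unitaryGroup_iff', star_eq_conjTranspose, conjTranspose_conjTranspose, hVu]
  refine ⟨V₁, hV₁, V₂, hV₂, ?_⟩
  rw [hVH, ← symplR_mul]
  refine symplR_eq_symplD (mul_mem hU hVm) ?_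
  calc (U * Vᴴ)ᵀ * (U * Vᴴ) = (Vᴴ)ᵀ * (Uᵀ * U) * Vᴴ := by
        rw [transpose_mul]; simp only [Matrix.mul_assoc]
    _ = (Vᴴ)ᵀ * V * (V * Vᴴ) := by rw [← hVV]; simp only [Matrix.mul_assoc]
    _ = (V * Vᴴ)ᵀ := by rw [transpose_mul, hVs, hVu, Matrix.mul_one]
    _ = 1 := by rw [hVu, transpose_one]

/-- Pure frequency shifts are fixed by `V_Q`, which is why the chirp does not affect `|F|²`. -/
theorem symplV_mul_symplD_mulVec {n : Type} [Fintype n] [DecidableEq n] (Q : Matrix n n ℝ)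
    {N : Matrix n n ℝ} (hN : IsUnit N.det) (ω : n → ℝ) :
    (symplV Q * symplD N) *ᵥ Sum.elim (0 : n → ℝ) (Nᵀ *ᵥ ω) = Sum.elim (0 : n → ℝ) ω := by
  have hN' : IsUnit Nᵀ.det := by rwa [det_transpose]
  rw [← mulVec_mulVec]
  simp [symplV, symplD, fromBlocks_mulVec, Sum.elim_comp_inl, Sum.elim_comp_inr,
    nonsing_inv_mul _ hN']

/-- The phase space coordinates belonging to the first group of variables. -/
def phaseFst {ι κ : Type} (l : (ι ⊕ κ) ⊕ (ι ⊕ κ) → ℝ) : ι ⊕ ι → ℝ :=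
  Sum.elim (fun i => l (Sum.inl (Sum.inl i))) fun i => l (Sum.inr (Sum.inl i))

/-- The phase space coordinates belonging to the second group of variables. -/
def phaseSnd {ι κ : Type} (l : (ι ⊕ κ) ⊕ (ι ⊕ κ) → ℝ) : κ ⊕ κ → ℝ :=
  Sum.elim (fun i => l (Sum.inl (Sum.inr i))) fun i => l (Sum.inr (Sum.inr i))

variable {ι κ : Type} [Fintype ι] [Fintype κ]

theorem phaseFst_symplR_mulVec (V₁ : Matrix ι ι ℂ) (V₂ : Matrix κ κ ℂ)
    (l : (ι ⊕ κ) ⊕ (ι ⊕ κ) → ℝ) :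
    phaseFst (symplR (fromBlocks V₁ 0 0 V₂) *ᵥ l) = symplR V₁ *ᵥ phaseFst l := by
  ext (i | i) <;> simp [phaseFst, symplR, mulVec, dotProduct]

theorem phaseSnd_symplR_mulVec (V₁ : Matrix ι ι ℂ) (V₂ : Matrix κ κ ℂ)
    (l : (ι ⊕ κ) ⊕ (ι ⊕ κ) → ℝ) :
    phaseSnd (symplR (fromBlocks V₁ 0 0 V₂) *ᵥ l) = symplR V₂ *ᵥ phaseSnd l := by
  ext (i | i) <;> simp [phaseSnd, symplR, mulVec, dotProduct]

theorem tensor_coeFn (f : L2 ι) (g : L2 κ) : tensor f g =ᵐ[volume] tensorFun f g :=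
  MemLp.coeFn_toLp _

theorem quasiMeasurePreserving_split_fst : Measure.QuasiMeasurePreserving
    (fun z : EuclideanSpace ℝ (ι ⊕ κ) =>
      (WithLp.toLp 2 fun i => z (Sum.inl i) : EuclideanSpace ℝ ι)) volume volume :=
  Measure.quasiMeasurePreserving_fst.comp (measurePreserving_split ι κ).quasiMeasurePreserving

theorem quasiMeasurePreserving_split_snd : Measure.QuasiMeasurePreserving
    (fun z : EuclideanSpace ℝ (ι ⊕ κ) =>
      (WithLp.toLp 2 fun j => z (Sum.inr j) : EuclideanSpace ℝ κ)) volume volume :=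
  Measure.quasiMeasurePreserving_snd.comp (measurePreserving_split ι κ).quasiMeasurePreserving

theorem inner_tensor (f f' : L2 ι) (g g' : L2 κ) :
    inner ℂ (tensor f g) (tensor f' g') = inner ℂ f f' * inner ℂ g g' := by
  rw [L2.inner_def, L2.inner_def, L2.inner_def, ← integral_prod_mul,
    ← (measurePreserving_split ι κ).map_eq, integral_map
      (measurePreserving_split ι κ).measurable.aemeasurable]
  · refine integral_congr_ae ?_
    filter_upwards [tensor_coeFn f g, tensor_coeFn f' g'] with z h1 h2
    rw [h1, h2]
    simp only [tensorFun, RCLike.inner_apply, map_mul]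
    ring
  · rw [(measurePreserving_split ι κ).map_eq]
    exact ((Lp.aestronglyMeasurable f).inner (Lp.aestronglyMeasurable f')).comp_fst.mul
      ((Lp.aestronglyMeasurable g).inner (Lp.aestronglyMeasurable g')).comp_snd

theorem phaseShift_tensor (l : (ι ⊕ κ) ⊕ (ι ⊕ κ) → ℝ) (f : L2 ι) (g : L2 κ) :
    phaseShift l (tensor f g) = tensor (phaseShift (phaseFst l) f) (phaseShift (phaseSnd l) g) := by
  apply Lp.ext
  filter_upwards [tfShift_coeFn (WithLp.toLp 2 fun i => l (Sum.inl i))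
      (WithLp.toLp 2 fun i => l (Sum.inr i)) (tensor f g),
    (measurePreserving_sub_right volume (WithLp.toLp 2 fun i => l (Sum.inl i) :
      EuclideanSpace ℝ (ι ⊕ κ))).quasiMeasurePreserving.ae (tensor_coeFn f g),
    tensor_coeFn (phaseShift (phaseFst l) f) (phaseShift (phaseSnd l) g),
    quasiMeasurePreserving_split_fst.ae (tfShift_coeFn
      (WithLp.toLp 2 fun i => phaseFst l (Sum.inl i))
      (WithLp.toLp 2 fun i => phaseFst l (Sum.inr i)) f),
    quasiMeasurePreserving_split_snd.ae (tfShift_coeFn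
      (WithLp.toLp 2 fun i => phaseSnd l (Sum.inl i))
      (WithLp.toLp 2 fun i => phaseSnd l (Sum.inr i)) g)] with z h1 h2 h3 h4 h5
  refine h1.trans (Eq.trans ?_ h3.symm)
  rw [tfShiftFun_apply, h2, tensorFun, tensorFun, phaseShift, phaseShift, h4, h5, tfShiftFun_apply,
    tfShiftFun_apply]
  obtain ⟨z⟩ := z
  have hf : tfFactor (WithLp.toLp 2 fun i => l (Sum.inl i) : EuclideanSpace ℝ (ι ⊕ κ))
      (WithLp.toLp 2 fun i => l (Sum.inr i)) (WithLp.toLp 2 z) =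
      tfFactor (WithLp.toLp 2 fun i => phaseFst l (Sum.inl i))
        (WithLp.toLp 2 fun i => phaseFst l (Sum.inr i)) (WithLp.toLp 2 fun i => z (Sum.inl i)) *
      tfFactor (WithLp.toLp 2 fun i => phaseSnd l (Sum.inl i))
        (WithLp.toLp 2 fun i => phaseSnd l (Sum.inr i)) (WithLp.toLp 2 fun i => z (Sum.inr i)) := by
    simp only [tfFactor, ← Complex.exp_add, inner_toLp, dotProduct, Fintype.sum_sum_type, phaseFst,
      phaseSnd, Sum.elim_inl, Sum.elim_inr]
    congr 1
    push_cast
    ring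
  rw [hf]
  exact mul_mul_mul_comm _ _ _ _

/-- Covariance moves the rotation by `V` from phase space to the window, where `T` cancels it. -/
theorem inner_phaseShift_symm [DecidableEq ι] {V : Matrix ι ι ℂ} (hV : V ∈ unitaryGroup ι ℂ)
    {T : L2 ι ≃ₗᵢ[ℂ] L2 ι} (hT : IsMetaplectic (symplR V) T) (φ : L2 ι) (l : ι ⊕ ι → ℝ) :
    inner ℂ (T.symm φ) (phaseShift (symplR Vᴴ *ᵥ l) (T.symm φ)) = inner ℂ φ (phaseShift l φ) := by
  rw [← T.inner_map_map, T.apply_symm_apply, ← hT, symplR_conjTranspose_mulVec hV]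

end Block

/-! ### The density `|F|²` and its characteristic function. -/

section Density

variable {ι : Type} [Fintype ι]

/-- The measure with density `|F|²`. -/
def sqDensity (F : L2 ι) : Measure (EuclideanSpace ℝ ι) :=
  volume.withDensity fun z => ((‖F z‖₊ ^ 2 : NNReal) : ENNReal)

theorem measurable_nnnorm_sq (F : L2 ι) : Measurable fun z => ‖F z‖₊ ^ 2 :=
  (Lp.stronglyMeasurable F).measurable.nnnorm.pow_const 2

theorem lintegral_sq_lt_top (F : L2 ι) :
    ∫⁻ z, ((‖F z‖₊ ^ 2 : NNReal) : ENNReal) < ⊤ := by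
  have h := ((memLp_two_iff_integrable_sq_norm (Lp.aestronglyMeasurable F)).1 (Lp.memLp F)).2
  refine lt_of_eq_of_lt (lintegral_congr fun z => ?_) h
  simp [enorm_eq_nnnorm]

instance (F : L2 ι) : IsFiniteMeasure (sqDensity F) :=
  isFiniteMeasure_withDensity (lintegral_sq_lt_top F).ne

/-- `ρ(0, ω)` is multiplication by `e^{2πi ω·t}`, so the inner product integrates this character
against `|F|²`. -/
theorem charFun_sqDensity (F : L2 ι) (ω : EuclideanSpace ℝ ι) :
    charFun (sqDensity F) ((2 * Real.pi) • ω) = inner ℂ F (tfShift 0 ω F) := by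
  rw [charFun_apply, sqDensity, integral_withDensity_eq_integral_smul (measurable_nnnorm_sq F),
    L2.inner_def]
  refine integral_congr_ae ?_
  filter_upwards [tfShift_coeFn 0 ω F] with z hz
  rw [hz, tfShiftFun]
  simp only [inner_zero_left, mul_zero, neg_zero, Complex.ofReal_zero, zero_mul, Complex.exp_zero,
    one_mul, sub_zero, RCLike.inner_apply, inner_smul_right, real_inner_comm]
  rw [NNReal.smul_def, Complex.real_smul, mul_assoc (Complex.exp _), RCLike.mul_conj, mul_comm]
  push_cast
  rfl

variable [DecidableEq ι]

theorem sqDensity_eq_map {F G : L2 ι} (N : Matrix ι ι ℝ)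
    (h : ∀ ω : ι → ℝ, inner ℂ F (tfShift 0 (WithLp.toLp 2 ω) F) =
      inner ℂ G (tfShift 0 (WithLp.toLp 2 (Nᵀ *ᵥ ω)) G)) :
    sqDensity F = Measure.map (toEuclideanLin N) (sqDensity G) := by
  have hc : Continuous (toEuclideanLin N) := LinearMap.continuous_of_finiteDimensional _
  have : IsFiniteMeasure (Measure.map (toEuclideanLin N) (sqDensity G)) :=
    Measure.isFiniteMeasure_map _ _
  refine Measure.ext_of_charFun (funext fun t => ?_)
  have ht : t = (2 * Real.pi) • (WithLp.toLp 2 ((2 * Real.pi)⁻¹ • t.ofLp)) := by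
    rw [WithLp.toLp_smul, smul_smul, mul_inv_cancel₀ (by positivity), one_smul]
  set ω := (2 * Real.pi)⁻¹ • t.ofLp
  rw [ht, charFun_sqDensity, h, ← charFun_sqDensity, charFun_apply, charFun_apply,
    integral_map hc.measurable.aemeasurable (by fun_prop)]
  refine integral_congr_ae (.of_forall ?_)
  rintro ⟨z⟩
  simp only [inner_smul_right, toLpLin_toLp, inner_toLp, toLin'_apply]
  rw [dotProduct_mulVec, vecMul_transpose]

theorem exists_compact_bound {F G : L2 ι} {N : Matrix ι ι ℝ} (hN : IsUnit N.det)
    (h : sqDensity F = Measure.map (toEuclideanLin N) (sqDensity G))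
    {K : Set (EuclideanSpace ℝ ι)} (hK : IsCompact K)
    (hG : ∀ᵐ z, ‖G z‖₊ ^ 2 = K.indicator 1 z) :
    ∃ (K' : Set (EuclideanSpace ℝ ι)) (C : ℝ), IsCompact K' ∧
      ∀ᵐ z, ‖F z‖ ≤ C ∧ (z ∉ K' → F z = 0) := by
  have hdet : LinearMap.det (toEuclideanLin N) ≠ 0 := by
    rw [toEuclideanLin, LinearMap.det_toLpLin]; exact hN.ne_zero
  let Φ : EuclideanSpace ℝ ι ≃ᵐ EuclideanSpace ℝ ι :=
    (LinearMap.equivOfDetNeZero _ hdet).toContinuousLinearEquiv.toHomeomorph.toMeasurableEquiv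
  have hc : Continuous (toEuclideanLin N) := LinearMap.continuous_of_finiteDimensional _
  have hK' : IsCompact (Φ '' K) := hK.image hc
  have hm := Measure.map_linearMap_addHaar_eq_smul_addHaar volume hdet
  set c := |(LinearMap.det (toEuclideanLin N))⁻¹|
  have h1 : sqDensity G = volume.restrict K := by
    rw [← withDensity_indicator_one hK.measurableSet]
    refine withDensity_congr_ae ?_
    filter_upwards [hG] with z hz
    rw [hz]
    by_cases hzK : z ∈ K <;> simp [hzK]
  -- The push-forward of Lebesgue measure on `K` is a constant multiple of Lebesgue measure on the
  -- image; uniqueness of densities then identifies `|F|²` almost everywhere.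
  have h2 : sqDensity F = volume.withDensity ((Φ '' K).indicator fun _ => ENNReal.ofReal c) := by
    rw [withDensity_indicator hK'.measurableSet, withDensity_const, h, h1, ← Measure.restrict_smul,
      ← hm]
    change Measure.map Φ _ = (Measure.map Φ volume).restrict _
    rw [Φ.restrict_map, Φ.preimage_image]
  have h3 := (withDensity_eq_iff (measurable_nnnorm_sq F).coe_nnreal_ennreal.aemeasurable
    (measurable_const.indicator hK'.measurableSet).aemeasurable (lintegral_sq_lt_top F).ne).1 h2
  refine ⟨Φ '' K, Real.sqrt c, hK', ?_⟩
  filter_upwards [h3] with z hz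
  constructor
  · refine Real.le_sqrt_of_sq_le ?_
    have : ((‖F z‖₊ ^ 2 : NNReal) : ENNReal) ≤ ENNReal.ofReal c := by
      rw [hz]; exact Set.indicator_le_self' (fun _ _ => zero_le) z
    rw [ENNReal.ofReal, ENNReal.coe_le_coe] at this
    have h4 := NNReal.coe_le_coe.2 this
    rwa [Real.coe_toNNReal _ (abs_nonneg _)] at h4
  · intro hzK
    simpa [hzK] using hz

end Density

/-! ### Decay and integrability of bounded functions with compact support. -/

section Decay

variable {ι : Type} [Fintype ι]

theorem exists_le_mul_of_compact_bound {F : L2 ι} {K : Set (EuclideanSpace ℝ ι)} {C : ℝ}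
    (hK : IsCompact K) (hF : ∀ᵐ z, ‖F z‖ ≤ C ∧ (z ∉ K → F z = 0))
    {φ : EuclideanSpace ℝ ι → ℝ} (hφ : Continuous φ) (hpos : ∀ z, 0 < φ z) :
    ∃ C' : ℝ, ∀ᵐ z, ‖F z‖ ≤ C' * φ z := by
  -- A positive lower bound of `φ` on `K`, available also for empty `K`.
  obtain ⟨a, ha, haK⟩ := hK.exists_forall_le' hφ.continuousOn (a := 0) fun z _ => hpos z
  refine ⟨|C| / a, ?_⟩
  filter_upwards [hF] with z hz
  by_cases hzK : z ∈ K
  · calc ‖F z‖ ≤ |C| := hz.1.trans (le_abs_self C)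
      _ = |C| / a * a := by field_simp
      _ ≤ |C| / a * φ z := by gcongr; exact haK z hzK
  · rw [hz.2 hzK, norm_zero]
    have := hpos z
    positivity

theorem integrable_rpow_mul_of_compact_bound {F : L2 ι} {K : Set (EuclideanSpace ℝ ι)} {C : ℝ}
    (hK : IsCompact K) (hF : ∀ᵐ z, ‖F z‖ ≤ C ∧ (z ∉ K → F z = 0))
    {p : ℝ} (hp : 0 < p) {v : EuclideanSpace ℝ ι → ℝ} (hv : LocallyIntegrable v volume) :
    Integrable (fun z => ‖F z‖ ^ p * v z) volume := by
  have h1 : Integrable (K.indicator v) volume :=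
    (hv.integrableOn_isCompact hK).integrable_indicator hK.measurableSet
  have h2 : Integrable (fun z => ‖F z‖ ^ p * K.indicator v z) volume := by
    refine h1.bdd_mul (c := C ^ p)
      ((Lp.stronglyMeasurable F).measurable.norm.pow_const p).aestronglyMeasurable ?_
    filter_upwards [hF] with z hz
    rw [Real.norm_of_nonneg (by positivity)]
    exact Real.rpow_le_rpow (norm_nonneg _) hz.1 hp.le
  refine h2.congr ?_
  filter_upwards [hF] with z hz
  by_cases hzK : z ∈ K
  · simp [hzK]
  · simp [hz.2 hzK, Real.zero_rpow hp.ne']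

end Decay

/-! ### The window: the indicator of a ball. -/

section Ball

/-- The indicator function of the closed unit ball. -/
def ballIndicator (ι : Type) [Fintype ι] : L2 ι :=
  indicatorConstLp 2 (isCompact_closedBall (0 : EuclideanSpace ℝ ι) 1).measurableSet
    (isCompact_closedBall _ _).measure_lt_top.ne 1

variable {ι κ : Type} [Fintype ι] [Fintype κ]

theorem ballIndicator_ne_zero : ballIndicator ι ≠ 0 := by
  rw [← norm_ne_zero_iff, ballIndicator, norm_indicatorConstLp (by simp) (by simp)]
  have h : 0 < volume.real (Metric.closedBall (0 : EuclideanSpace ℝ ι) 1) :=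
    ENNReal.toReal_pos (Metric.measure_closedBall_pos volume _ one_pos).ne'
      (isCompact_closedBall _ _).measure_lt_top.ne
  rw [norm_one, one_mul]
  positivity

theorem nnnorm_tensor_ballIndicator :
    ∃ K : Set (EuclideanSpace ℝ (ι ⊕ κ)), IsCompact K ∧
      ∀ᵐ z, ‖tensor (ballIndicator ι) (ballIndicator κ) z‖₊ ^ 2 = K.indicator 1 z := by
  let s : EuclideanSpace ℝ (ι ⊕ κ) → EuclideanSpace ℝ ι × EuclideanSpace ℝ κ := fun z =>
    (WithLp.toLp 2 fun i => z (Sum.inl i), WithLp.toLp 2 fun j => z (Sum.inr j))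
  let b : EuclideanSpace ℝ ι × EuclideanSpace ℝ κ → EuclideanSpace ℝ (ι ⊕ κ) := fun p =>
    WithLp.toLp 2 (Sum.elim p.1.ofLp p.2.ofLp)
  have hb : Continuous b := by
    refine (PiLp.continuous_toLp 2 _).comp (continuous_pi ?_)
    rintro (i | i) <;> simp only [Sum.elim_inl, Sum.elim_inr] <;> fun_prop
  let B := Metric.closedBall (0 : EuclideanSpace ℝ ι) 1 ×ˢ
    Metric.closedBall (0 : EuclideanSpace ℝ κ) 1
  have hbs (z) : b (s z) = z := by ext (i | i) <;> rfl
  have hsb (p) : s (b p) = p := rfl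
  refine ⟨b '' B, ((isCompact_closedBall _ _).prod (isCompact_closedBall _ _)).image hb, ?_⟩
  filter_upwards [tensor_coeFn (ballIndicator ι) (ballIndicator κ),
    quasiMeasurePreserving_split_fst.ae (indicatorConstLp_coeFn (p := 2)
      (hs := (isCompact_closedBall (0 : EuclideanSpace ℝ ι) 1).measurableSet)
      (hμs := (isCompact_closedBall _ _).measure_lt_top.ne) (c := (1 : ℂ))),
    quasiMeasurePreserving_split_snd.ae (indicatorConstLp_coeFn (p := 2)
      (hs := (isCompact_closedBall (0 : EuclideanSpace ℝ κ) 1).measurableSet)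
      (hμs := (isCompact_closedBall _ _).measure_lt_top.ne) (c := (1 : ℂ)))] with z h1 h2 h3
  have hz : z ∈ b '' B ↔ (s z).1 ∈ Metric.closedBall 0 1 ∧ (s z).2 ∈ Metric.closedBall 0 1 := by
    rw [← Set.mem_prod]
    refine ⟨?_, fun h => ⟨s z, h, hbs z⟩⟩
    rintro ⟨p, hp, rfl⟩
    rwa [hsb]
  rw [h1, tensorFun, ballIndicator, ballIndicator, h2, h3]
  by_cases ha : (s z).1 ∈ Metric.closedBall 0 1 <;> by_cases hb' : (s z).2 ∈ Metric.closedBall 0 1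
  all_goals
    have hz' := hz
    simp only [ha, hb', and_self, and_true, and_false, iff_true, iff_false] at hz'
    rw [show (WithLp.toLp 2 fun i => z (Sum.inl i) : EuclideanSpace ℝ ι) = (s z).1 from rfl,
      show (WithLp.toLp 2 fun j => z (Sum.inr j) : EuclideanSpace ℝ κ) = (s z).2 from rfl]
    simp only [Set.indicator, ha, hb', hz', if_true, if_false]
    simp

end Ball

end

/-! ### Assembly of the proof. -/

theorem mainTheorem12 (d : ℕ)
    (A : Matrix ((Fin d ⊕ Fin d) ⊕ (Fin d ⊕ Fin d)) ((Fin d ⊕ Fin d) ⊕ (Fin d ⊕ Fin d)) ℝ)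
    (hA : A ∈ Matrix.symplecticGroup (Fin d ⊕ Fin d) ℝ)
    (Q L : Matrix (Fin d ⊕ Fin d) (Fin d ⊕ Fin d) ℝ)
    (U : Matrix (Fin d ⊕ Fin d) (Fin d ⊕ Fin d) ℂ)
    (hQ : Qᵀ = Q) (hL : IsUnit L.det)
    (hU : U ∈ Matrix.unitaryGroup (Fin d ⊕ Fin d) ℂ)
    (hdec : A = symplV Q * symplD L * symplR U)
    (hblock : IsBlockDiag (Uᵀ * U)) :
    (∃ T : L2 (Fin d ⊕ Fin d) ≃ₗᵢ[ℂ] L2 (Fin d ⊕ Fin d), IsMetaplectic A T) ∧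
    ∃ f g : L2 (Fin d), f ≠ 0 ∧ g ≠ 0 ∧
      ∀ T : L2 (Fin d ⊕ Fin d) ≃ₗᵢ[ℂ] L2 (Fin d ⊕ Fin d), IsMetaplectic A T →
        HasCompactEssSupport (metaplecticTFR T f g) ∧
        (∀ φ : EuclideanSpace ℝ (Fin d ⊕ Fin d) → ℝ, Continuous φ → (∀ z, 0 < φ z) →
          ∃ C : ℝ, ∀ᵐ z, ‖metaplecticTFR T f g z‖ ≤ C * φ z) ∧
        (∀ (p : ℝ) (v : EuclideanSpace ℝ (Fin d ⊕ Fin d) → ℝ), 0 < p →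
          LocallyIntegrable v volume →
          Integrable (fun z => ‖metaplecticTFR T f g z‖ ^ p * v z) volume) := by
  obtain ⟨U₁, U₂, hb⟩ := hblock
  obtain ⟨V₁, hV₁, V₂, hV₂, M, hM, hUV⟩ := exists_block_factor hU hb
  obtain ⟨TQ, hTQ⟩ := exists_isMetaplectic_symplV hQ
  obtain ⟨TL, hTL⟩ := exists_isMetaplectic_symplD hL
  obtain ⟨TU, hTU⟩ := exists_isMetaplectic_symplR hU
  obtain ⟨T₁, hT₁⟩ := exists_isMetaplectic_symplR hV₁
  obtain ⟨T₂, hT₂⟩ := exists_isMetaplectic_symplR hV₂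
  have hN : IsUnit (L * M).det := by rw [det_mul]; exact hL.mul hM
  set φ := ballIndicator (Fin d)
  have hφ (T : L2 (Fin d) ≃ₗᵢ[ℂ] L2 (Fin d)) : T.symm φ ≠ 0 :=
    (map_ne_zero_iff _ T.symm.injective).2 ballIndicator_ne_zero
  -- The choice of `f` and `g` uses fixed `T₁`, `T₂` and so precedes `T`. The `star` cancels the
  -- conjugation in `metaplecticTFR`.
  refine ⟨⟨_, hdec ▸ (hTQ.mul hTL).mul hTU⟩, T₁.symm φ, star (T₂.symm φ), hφ T₁, ?_, ?_⟩
  · intro h0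
    apply hφ T₂
    rw [← star_star (T₂.symm φ), h0]
    apply Lp.ext
    filter_upwards [Lp.coeFn_star (0 : L2 (Fin d)),
      Lp.coeFn_zero ℂ 2 (volume : Measure (EuclideanSpace ℝ (Fin d)))] with z h1 h2
    rw [h1, Pi.star_apply, h2, Pi.zero_apply, star_zero]
  intro T hT
  have key (ω : Fin d ⊕ Fin d → ℝ) :
      inner ℂ (metaplecticTFR T (T₁.symm φ) (star (T₂.symm φ)))
        (tfShift 0 (WithLp.toLp 2 ω) (metaplecticTFR T (T₁.symm φ) (star (T₂.symm φ)))) =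
      inner ℂ (tensor φ φ) (tfShift 0 (WithLp.toLp 2 ((L * M)ᵀ *ᵥ ω)) (tensor φ φ)) := by
    -- The preimage of `(0, ω)` under `A`; its block form lets the inner product split into two
    -- factors.
    set l := symplR (fromBlocks V₁ᴴ 0 0 V₂ᴴ) *ᵥ Sum.elim (0 : Fin d ⊕ Fin d → ℝ) ((L * M)ᵀ *ᵥ ω)
    have hl : A *ᵥ l = Sum.elim (0 : Fin d ⊕ Fin d → ℝ) ω := by
      rw [mulVec_mulVec, hdec, Matrix.mul_assoc _ (symplR U), hUV, Matrix.mul_assoc, ← symplD_mul,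
        symplV_mul_symplD_mulVec Q hN]
    change inner ℂ _ (phaseShift (Sum.elim (0 : Fin d ⊕ Fin d → ℝ) ω) _) =
      inner ℂ _ (phaseShift (Sum.elim (0 : Fin d ⊕ Fin d → ℝ) ((L * M)ᵀ *ᵥ ω)) _)
    rw [metaplecticTFR, star_star, ← hl, isMetaplectic_iff.1 hT, T.inner_map_map,
      phaseShift_tensor, inner_tensor, phaseFst_symplR_mulVec, phaseSnd_symplR_mulVec,
      inner_phaseShift_symm hV₁ hT₁, inner_phaseShift_symm hV₂ hT₂, ← inner_tensor,
      ← phaseShift_tensor]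
  obtain ⟨K₀, hK₀, hG⟩ := nnnorm_tensor_ballIndicator (ι := Fin d) (κ := Fin d)
  obtain ⟨K, C, hK, hF⟩ := exists_compact_bound hN (sqDensity_eq_map (L * M) key) hK₀ hG
  exact ⟨⟨K, hK, hF.mono fun z hz => hz.2⟩,
    fun _ hc hpos => exists_le_mul_of_compact_bound hK hF hc hpos,
    fun _ _ hp hv => integrable_rpow_mul_of_compact_bound hK hF hp hv⟩
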